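/- Let $E$ be a complex Hilbert space and let $\Omega$ be the set of positive definite (that is, positive semidefinite and invertible) bounded operators on $E$, with the Loewner order ($A\le B$ iff $B-A$ is positive semidefinite) and the Thompson metric $$d(A,B)=\max\{\log M(A/B),\log M(B/A)\},\qquad M(A/B)=\inf\{\lambda>0: A\le\lambda B\}$$ (when $E=\{0\}$, $\Omega$ is a single point and $d=0$). The operator logarithmic mean on $\Omega$ is $$L(A,B)=A^{1/2}f\bigl(A^{-1/2}BA^{-1/2}\bigr)A^{1/2},\qquad f(x)=\frac{x-1}{\log x}\ (x>0,\ x\ne 1),\quad f(1)=1.$$ A $k$-mean on a set $X$ is a map $\mu:X^k\to X$ with $\mu(x,\dots,x)=x$ for all $x\in X$. On a metric space it is nonexpansive if $d(\mu(\mathbf x),\mu(\mathbf y))\le\max_j d(x_j,y_j)$ for all $\mathbf x,\mathbf y\in X^k$, and coordinatewise $\rho$-contractive if $d(\mu(\mathbf x),\mu(\mathbf y))\le\rho\,d(x_j,y_j)$ whenever $\mathbf x$ and $\mathbf y$ differ at most in the $j$-th coordinate. For a $k$-mean $\mu$ let $\beta_\mu:X^{k+1}\to X^{k+1}$ be the map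 whose $i$-th coordinate at $\mathbf x$ is the value of $\mu$ on the $k$-tuple obtained from $\mathbf x$ by deleting $x_i$. A $(k+1)$-mean $\nu$ is a $\beta$-extension of a continuous $k$-mean $\mu$ if $\lim_{m\to\infty}\beta_\mu^m(\mathbf x)=(\nu(\mathbf x),\dots,\nu(\mathbf x))$ for every $\mathbf x\in X^{k+1}$. Then: 1. For every integer $n\ge1$ the order interval $[(1/n)I,nI]=\{A\in\Omega:(1/n)I\le A\le nI\}$ is closed under $L$, and the restriction of $L$ to it is a $2$-mean that is nonexpansive and, for some $\rho_n$ with $0<\rho_n<1$, coordinatewise $\rho_n$-contractive for the Thompson metric. 2. On $\Omega$ the logarithmic mean inductively $\beta$-extends to an $n$-mean for every $n>2$: there are continuous $n$-means $L_n:\Omega^n\to\Omega$ for $n\ge2$, with $L_2=L$, such that $L_{n+1}$ is a $\beta$-extension of $L_n$ for every $n\ge2$. -/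

import Mathlib

open Filter Topology

namespace OperatorMeans

noncomputable section

section GeneralMeans

/-- A `k`-mean on `X`: a `k`-ary operation with `μ (x, …, x) = x` (used for `k ≥ 2`). -/
def IsMean {X : Type*} {k : ℕ} (μ : (Fin k → X) → X) : Prop :=
  ∀ x : X, μ (fun _ => x) = x

/-- A topological `k`-mean: a continuous `k`-mean on a Hausdorff space. -/
def IsTopologicalMean {X : Type*} [TopologicalSpace X] [T2Space X] {k : ℕ}
    (μ : (Fin k → X) → X) : Prop :=
  IsMean μ ∧ Continuous μ

/-- The barycentric operator `β_μ : X^{k+1} → X^{k+1}`: its `i`-th coordinate is `μ` applied to the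
tuple with the `i`-th entry deleted. -/
def barycentric {X : Type*} {k : ℕ} (μ : (Fin k → X) → X) (x : Fin (k + 1) → X) :
    Fin (k + 1) → X :=
  fun i => μ (fun j => x (i.succAbove j))

/-- The `(k+1)`-mean `ν` is a `β`-extension of the topological `k`-mean `μ`:
`β_μ^m (x) → (ν x, …, ν x)` for every `x`. -/
def IsBetaExtension {X : Type*} [TopologicalSpace X] [T2Space X] {k : ℕ}
    (μ : (Fin k → X) → X) (ν : (Fin (k + 1) → X) → X) : Prop :=
  IsTopologicalMean μ ∧ IsMean ν ∧
    ∀ x : Fin (k + 1) → X,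
      Tendsto (fun m : ℕ => (barycentric μ)^[m] x) atTop (𝓝 (fun _ => ν x))

/-- The `k`-mean `μ` inductively `β`-extends to an `n`-mean for every `n > k`: starting from
`ν_k = μ` there are topological `n`-means `ν_n` (`n ≥ k`), each a `β`-extension of the preceding
one.  The entries `ν n` with `n < k` play no role. -/
def InductivelyBetaExtends {X : Type*} [TopologicalSpace X] [T2Space X] {k : ℕ}
    (μ : (Fin k → X) → X) : Prop :=
  ∃ ν : (n : ℕ) → (Fin n → X) → X,
    ν k = μ ∧ ∀ n, k ≤ n → IsTopologicalMean (ν n) ∧ IsBetaExtension (ν n) (ν (n + 1))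

/-- A `k`-mean is nonexpansive if `d (μ x, μ y) ≤ max_j d (x_j, y_j)`.  The maximum is the distance
of `x` and `y` in the product `Fin k → X`, which carries the sup metric. -/
def Nonexpansive {X : Type*} [MetricSpace X] {k : ℕ} (μ : (Fin k → X) → X) : Prop :=
  ∀ x y : Fin k → X, dist (μ x) (μ y) ≤ dist x y

/-- Coordinatewise `ρ`-contractive: if `x` and `y` differ at most in the coordinate `j` then
`d (μ x, μ y) ≤ ρ d (x_j, y_j)`. -/
def CoordinatewiseContractive {X : Type*} [MetricSpace X] {k : ℕ} (ρ : ℝ)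
    (μ : (Fin k → X) → X) : Prop :=
  ∀ (x y : Fin k → X) (j : Fin k), (∀ i, i ≠ j → x i = y i) →
    dist (μ x) (μ y) ≤ ρ * dist (x j) (y j)

/-- A subset is convex for `μ` if it is closed under `μ`. -/
def IsConvexFor {X : Type*} {k : ℕ} (μ : (Fin k → X) → X) (S : Set X) : Prop :=
  ∀ x : Fin k → X, (∀ i, x i ∈ S) → μ x ∈ S

/-- The restriction of `μ` to a subset that is convex for it. -/
def restrictMean {X : Type*} {k : ℕ} (μ : (Fin k → X) → X) (S : Set X)
    (hS : IsConvexFor μ S) : (Fin k → S) → S :=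
  fun x => ⟨μ (fun i => (x i : X)), hS _ (fun i => (x i).2)⟩

end GeneralMeans

section PositiveOperators

/-- The set `Ω` of positive definite operators on the Hilbert space `E`: the bounded operators that
are positive semidefinite and invertible. -/
@[ext]
structure PosOp (E : Type*) [NormedAddCommGroup E] [InnerProductSpace ℂ E] [CompleteSpace E] where
  /-- the underlying bounded operator -/
  op : E →L[ℂ] E
  isStrictlyPositive : IsStrictlyPositive op

variable {E : Type*} [NormedAddCommGroup E] [InnerProductSpace ℂ E] [CompleteSpace E]

/-- `M(A/B) = inf {λ > 0 : A ≤ λ B}`, for the Loewner order. -/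
def thompsonM (A B : PosOp E) : ℝ :=
  sInf {l : ℝ | 0 < l ∧ A.op ≤ l • B.op}

/-- The Thompson metric `d(A,B) = max {log M(A/B), log M(B/A)}`. -/
def thompsonDist (A B : PosOp E) : ℝ :=
  max (Real.log (thompsonM A B)) (Real.log (thompsonM B A))

theorem exists_le_smul (A B : PosOp E) : ∃ l : ℝ, 0 < l ∧ A.op ≤ l • B.op := by
  rcases subsingleton_or_nontrivial (E →L[ℂ] E) with h | h
  · exact ⟨1, one_pos, le_of_eq (Subsingleton.elim _ _)⟩
  obtain ⟨r, hr, hrB⟩ := (CFC.exists_pos_algebraMap_le_iff (a := B.op)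
    (B.isStrictlyPositive.isSelfAdjoint)).2
    (fun x hx => B.isStrictlyPositive.spectrum_pos hx)
  have hA : A.op ≤ algebraMap ℝ (E →L[ℂ] E) ‖A.op‖ :=
    A.isStrictlyPositive.isSelfAdjoint.le_algebraMap_norm_self
  have hA0 : 0 < ‖A.op‖ := norm_pos_iff.2 A.isStrictlyPositive.isUnit.ne_zero
  refine ⟨‖A.op‖ / r, by positivity, hA.trans ?_⟩
  have h2 := smul_le_smul_of_nonneg_left hrB (show 0 ≤ ‖A.op‖ / r by positivity)
  refine le_trans (le_of_eq ?_) h2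
  rw [Algebra.algebraMap_eq_smul_one, Algebra.algebraMap_eq_smul_one, smul_smul,
    div_mul_cancel₀ _ hr.ne']

theorem thompsonM_nonneg (A B : PosOp E) : 0 ≤ thompsonM A B :=
  Real.sInf_nonneg (fun _ h => h.1.le)

theorem le_thompsonM_smul (A B : PosOp E) : A.op ≤ thompsonM A B • B.op := by
  have hcl : IsClosed {l : ℝ | A.op ≤ l • B.op} :=
    isClosed_le continuous_const (continuous_id.smul continuous_const)
  have hmem : thompsonM A B ∈ closure {l : ℝ | 0 < l ∧ A.op ≤ l • B.op} :=
    csInf_mem_closure (exists_le_smul A B) ⟨0, fun _ h => h.1.le⟩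
  exact (hcl.closure_subset_iff.2 (fun _ h => h.2)) hmem

theorem thompsonM_pos [Nontrivial (E →L[ℂ] E)] (A B : PosOp E) : 0 < thompsonM A B := by
  refine lt_of_le_of_ne (thompsonM_nonneg A B) (fun h => ?_)
  have h1 := le_thompsonM_smul A B
  rw [← h, zero_smul] at h1
  exact A.isStrictlyPositive.isUnit.ne_zero (le_antisymm h1 A.isStrictlyPositive.nonneg)

theorem thompsonM_le {A B : PosOp E} {l : ℝ} (hl : 0 < l) (h : A.op ≤ l • B.op) :
    thompsonM A B ≤ l :=
  csInf_le ⟨0, fun _ h => h.1.le⟩ ⟨hl, h⟩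

theorem thompsonM_mul_le [Nontrivial (E →L[ℂ] E)] (A B C : PosOp E) :
    thompsonM A C ≤ thompsonM A B * thompsonM B C := by
  refine thompsonM_le (mul_pos (thompsonM_pos A B) (thompsonM_pos B C)) ?_
  refine (le_thompsonM_smul A B).trans ?_
  rw [mul_smul]
  exact smul_le_smul_of_nonneg_left (le_thompsonM_smul B C) (thompsonM_nonneg A B)

theorem thompsonM_self [Nontrivial (E →L[ℂ] E)] (A : PosOp E) : thompsonM A A = 1 := by
  refine le_antisymm (thompsonM_le one_pos (by rw [one_smul])) ?_
  have h := thompsonM_mul_le A A A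
  have h0 := thompsonM_pos A A
  nlinarith

theorem log_thompsonM_le [Nontrivial (E →L[ℂ] E)] (A B C : PosOp E) :
    Real.log (thompsonM A C) ≤ Real.log (thompsonM A B) + Real.log (thompsonM B C) := by
  rw [← Real.log_mul (thompsonM_pos A B).ne' (thompsonM_pos B C).ne']
  exact Real.log_le_log (thompsonM_pos A C) (thompsonM_mul_le A B C)

theorem op_le_of_log_nonpos [Nontrivial (E →L[ℂ] E)] {A B : PosOp E}
    (h : Real.log (thompsonM A B) ≤ 0) : A.op ≤ B.op := by
  have h1 : thompsonM A B ≤ 1 := by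
    by_contra hc
    exact absurd h (not_le.2 (Real.log_pos (not_le.1 hc)))
  calc A.op ≤ thompsonM A B • B.op := le_thompsonM_smul A B
    _ ≤ (1 : ℝ) • B.op := smul_le_smul_of_nonneg_right h1 B.isStrictlyPositive.nonneg
    _ = B.op := one_smul _ _

theorem thompsonDist_of_subsingleton [Subsingleton (E →L[ℂ] E)] (A B : PosOp E) :
    thompsonDist A B = 0 := by
  have h : ∀ A B : PosOp E, thompsonM A B = 0 := by
    intro A B
    have hs : {l : ℝ | 0 < l ∧ A.op ≤ l • B.op} = Set.Ioi 0 := by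
      ext l
      exact ⟨fun h => h.1, fun h => ⟨h, le_of_eq (Subsingleton.elim _ _)⟩⟩
    rw [thompsonM, hs, csInf_Ioi]
  simp [thompsonDist, h]

/-- `Ω` is a metric space with the Thompson metric; its topology is the topology of `Ω`. -/
instance : MetricSpace (PosOp E) where
  dist := thompsonDist
  dist_self A := by
    rcases subsingleton_or_nontrivial (E →L[ℂ] E) with h | h
    · exact thompsonDist_of_subsingleton A A
    · simp [thompsonDist, thompsonM_self]
  dist_comm A B := max_comm _ _
  dist_triangle A B C := by
    rcases subsingleton_or_nontrivial (E →L[ℂ] E) with h | h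
    · simp [thompsonDist_of_subsingleton]
    · refine max_le ?_ ?_
      · exact (log_thompsonM_le A B C).trans (add_le_add (le_max_left _ _) (le_max_left _ _))
      · refine (log_thompsonM_le C B A).trans ?_
        rw [add_comm]
        exact add_le_add (le_max_right _ _) (le_max_right _ _)
  eq_of_dist_eq_zero {A B} hAB := by
    rcases subsingleton_or_nontrivial (E →L[ℂ] E) with h | h
    · exact PosOp.ext (Subsingleton.elim _ _)
    · have hAB' : thompsonDist A B = 0 := hAB
      exact PosOp.ext (le_antisymm (op_le_of_log_nonpos ((le_max_left _ _).trans hAB'.le))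
        (op_le_of_log_nonpos ((le_max_right _ _).trans hAB'.le)))

variable (E) in
/-- The order interval `[(1/n) I, n I]`. -/
def orderInterval (n : ℕ) : Set (PosOp E) :=
  {A | (1 / (n : ℝ)) • (1 : E →L[ℂ] E) ≤ A.op ∧ A.op ≤ (n : ℝ) • (1 : E →L[ℂ] E)}

end PositiveOperators

section LogarithmicMean

/-- The logarithmic mean of positive reals, `L(a,b) = (b - a) / (log b - log a)`, with
`L(a,a) = a`. -/
def realLogMean (a b : ℝ) : ℝ :=
  if a = b then a else (b - a) / (Real.log b - Real.log a)

/-- Its representing function `f(x) = L(1,x) = (x - 1) / log x`. -/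
def logRep (x : ℝ) : ℝ := realLogMean 1 x

theorem logRep_eq (x : ℝ) : logRep x = (dslope Real.log 1 x)⁻¹ := by
  by_cases h : x = 1
  · subst h
    simp [logRep, realLogMean]
  · rw [dslope_of_ne _ h, slope_def_field]
    simp [logRep, realLogMean, Ne.symm h]

theorem dslope_log_pos {x : ℝ} (hx : 0 < x) : 0 < dslope Real.log 1 x := by
  rcases lt_trichotomy x 1 with h | h | h
  · rw [dslope_of_ne _ h.ne, slope_def_field, Real.log_one]
    exact div_pos_of_neg_of_neg (by linarith [Real.log_neg hx h]) (by linarith)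
  · subst h
    simp
  · rw [dslope_of_ne _ h.ne', slope_def_field, Real.log_one]
    exact div_pos (by linarith [Real.log_pos h]) (by linarith)

theorem logRep_pos {x : ℝ} (hx : 0 < x) : 0 < logRep x := by
  rw [logRep_eq]
  exact inv_pos.2 (dslope_log_pos hx)

theorem continuousOn_logRep : ContinuousOn logRep (Set.Ioi 0) := by
  have h1 : ContinuousOn (dslope Real.log 1) (Set.Ioi 0) :=
    (continuousOn_dslope (Ioi_mem_nhds one_pos)).2
      ⟨Real.continuousOn_log.mono (fun x hx => (Set.mem_Ioi.1 hx).ne'),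
        Real.differentiableAt_log one_ne_zero⟩
  exact (h1.inv₀ (fun x hx => (dslope_log_pos hx).ne')).congr (fun x _ => logRep_eq x)

variable {E : Type*} [NormedAddCommGroup E] [InnerProductSpace ℂ E] [CompleteSpace E]

/-- The operator attached to `f : (0,∞) → (0,∞)` and `A, B ∈ Ω`:
`A^{1/2} f(A^{-1/2} B A^{-1/2}) A^{1/2}`, with `f` applied by the functional calculus. -/
def perspective (f : ℝ → ℝ) (A B : E →L[ℂ] E) : E →L[ℂ] E :=
  A ^ (1 / 2 : ℝ) * cfc f (A ^ (-(1 / 2) : ℝ) * B * A ^ (-(1 / 2) : ℝ)) * A ^ (1 / 2 : ℝ)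

theorem isStrictlyPositive_perspective {f : ℝ → ℝ} (hf : ContinuousOn f (Set.Ioi 0))
    (hpos : ∀ x, 0 < x → 0 < f x) (A B : PosOp E) :
    IsStrictlyPositive (perspective f A.op B.op) := by
  have hconj : ∀ (t : ℝ) (X : E →L[ℂ] E), IsStrictlyPositive X →
      IsStrictlyPositive (A.op ^ t * X * A.op ^ t) := fun t X hX => by
    have h := IsStrictlyPositive.rpow A.op t A.isStrictlyPositive
    exact IsStrictlyPositive.conjugate_of_isUnit_of_isSelfAdjoint X _ h.isUnit h.isSelfAdjoint hX
  refine hconj _ _ ?_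
  have hC := hconj (-(1 / 2)) _ B.isStrictlyPositive
  set C := A.op ^ (-(1 / 2) : ℝ) * B.op * A.op ^ (-(1 / 2) : ℝ)
  have hsp : ∀ x ∈ spectrum ℝ C, 0 < x := fun x hx => hC.spectrum_pos hx
  refine IsUnit.isStrictlyPositive ?_ (cfc_nonneg fun x hx => (hpos x (hsp x hx)).le)
  exact (isUnit_cfc_iff f C (hf.mono hsp) hC.isSelfAdjoint).2 (fun x hx => (hpos x (hsp x hx)).ne')

/-- The operator logarithmic mean on `Ω`: the operator mean with representing function `logRep`. -/
def opLogMean (A B : PosOp E) : PosOp E :=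
  ⟨perspective logRep A.op B.op,
    isStrictlyPositive_perspective continuousOn_logRep (fun _ => logRep_pos) A B⟩

variable (E) in
/-- The operator logarithmic mean as an operation on pairs. -/
def logMean : (Fin 2 → PosOp E) → PosOp E :=
  fun x => opLogMean (x 0) (x 1)

end LogarithmicMean

end

end OperatorMeans

/-!
The logarithmic mean has the representation
`L(A, B)⁻¹ = ∫₀¹ ((1 - t) A + t B)⁻¹ dt`,
which follows by functional calculus and congruence from the scalar identity
`∫₀¹ dt / ((1 - t) + t x) = log x / (x - 1)` (`opLogMean_op`). The formula shows that `L` is symmetric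
and homogeneous and, since inversion reverses the Loewner order, jointly monotone. Monotonicity and
homogeneity make `L` nonexpansive for the Thompson metric (`dist_opLogMean_le`), and together with
`L(I, I) = I` they make `[(1/n) I, n I]` closed under `L`.

For coordinatewise contractivity let `δ = d(B, C)`, so that
`L(A, B) ≤ L(A, e^δ C) = e^δ L(e^{-δ} A, C)`. On `[(1/n) I, n I]` the operator `A` is at least a fixed
multiple of `(1 - t) A + t C`, so replacing `A` by `e^{-δ} A` lowers this operator by a definite
fraction of itself for `t < 1`, and integrating the inverses in `t` shows that `L(e^{-δ} A, C)` is at most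
`e^{-ε δ} L(A, C)` with `ε > 0` depending only on `n` (`one_add_smul_invLogMean_le`,
`opLogMean_le_exp_smul`).

Higher means come from a metric argument. Let `μ` be symmetric, nonexpansive, and coordinatewise
`ρ`-contractive with `ρ < 1` on a complete set `S` that is convex for `μ`. By symmetry two coordinates
of `β_μ x` are values of `μ` at tuples differing in one entry, so `β_μ` shrinks the diameter of a tuple
in `S` by `ρ`, while it moves the tuple by at most its diameter. Hence the iterates converge to a
constant tuple (`exists_tendsto_iterate_barycentric`). The limit mean is again symmetric, nonexpansive
and coordinatewise `ρ`-contractive with the same `ρ` (`exists_betaExtension`), so the construction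
can be repeated. It applies to `L` because the order intervals are complete for the Thompson metric
(`isComplete_orderInterval`) and every finite tuple lies in one of them; the constant may depend on
the interval.
-/

open Filter Topology

namespace OperatorMeans

/-! ### Extending locally contractive means to higher order -/

section Extension

/-- Two injective tuples with the same entries differ by a permutation of the indices. -/
theorem exists_perm_of_range_eq {k : ℕ} {α : Type*} {f g : Fin k → α} (hf : Function.Injective f)
    (hg : Function.Injective g) (h : Set.range f = Set.range g) :
    ∃ σ : Equiv.Perm (Fin k), f = g ∘ σ := by
  refine ⟨(Equiv.ofInjective f hf).trans ((Equiv.setCongr h).trans (Equiv.ofInjective g hg).symm),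
    ?_⟩
  funext i
  simp only [Function.comp_apply, Equiv.trans_apply]
  rw [Equiv.apply_ofInjective_symm hg]
  rfl

theorem IsMean.barycentric_const {X : Type*} {k : ℕ} {μ : (Fin k → X) → X} (h : IsMean μ) (a : X) :
    barycentric μ (fun _ => a) = fun _ => a :=
  funext fun _ => h a

/-- A symmetric nonexpansive `k`-mean for which every member of the family `S` is convex, and which
is coordinatewise `ρ i`-contractive on `S i`. -/
structure IsLocallyContractiveMean {X ι : Type*} [MetricSpace X] (S : ι → Set X) (ρ : ι → ℝ)
    {k : ℕ} (μ : (Fin k → X) → X) : Prop where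
  isMean : IsMean μ
  nonexpansive : Nonexpansive μ
  symm : ∀ (σ : Equiv.Perm (Fin k)) (x : Fin k → X), μ (x ∘ σ) = μ x
  convex : ∀ i, IsConvexFor μ (S i)
  contractive : ∀ i (x y : Fin k → X) (j : Fin k), (∀ l, x l ∈ S i) → (∀ l, y l ∈ S i) →
    (∀ l, l ≠ j → x l = y l) → dist (μ x) (μ y) ≤ ρ i * dist (x j) (y j)

variable {X ι : Type*} [MetricSpace X] {S : ι → Set X} {ρ : ι → ℝ} {k : ℕ} {μ : (Fin k → X) → X}

theorem Nonexpansive.continuous (h : Nonexpansive μ) : Continuous μ :=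
  (LipschitzWith.of_dist_le_mul (K := 1) (fun x y => by simpa using h x y)).continuous

theorem Nonexpansive.dist_barycentric_le (h : Nonexpansive μ) (x y : Fin (k + 1) → X) :
    dist (barycentric μ x) (barycentric μ y) ≤ dist x y := by
  refine (dist_pi_le_iff dist_nonneg).2 fun i => (h _ _).trans ?_
  exact (dist_pi_le_iff dist_nonneg).2 fun j => dist_le_pi_dist x y _

theorem Nonexpansive.dist_iterate_barycentric_le (h : Nonexpansive μ) (x y : Fin (k + 1) → X)
    (m : ℕ) : dist ((barycentric μ)^[m] x) ((barycentric μ)^[m] y) ≤ dist x y := by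
  induction m with
  | zero => exact le_rfl
  | succ m ih =>
    rw [Function.iterate_succ_apply', Function.iterate_succ_apply']
    exact (h.dist_barycentric_le _ _).trans ih

/-- A nonexpansive mean of `k` of the `x j` is no farther from `x i` than the farthest `x j`. -/
theorem dist_barycentric_self_le (hμ : IsMean μ) (hn : Nonexpansive μ) {x : Fin (k + 1) → X}
    {C : ℝ} (hC : ∀ i j, dist (x i) (x j) ≤ C) : dist (barycentric μ x) x ≤ C := by
  have hC0 : 0 ≤ C := dist_nonneg.trans (hC 0 0)
  refine (dist_pi_le_iff hC0).2 fun i => ?_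
  have h := hn (fun j => x (i.succAbove j)) (fun _ => x i)
  rw [hμ] at h
  exact h.trans ((dist_pi_le_iff hC0).2 fun j => hC _ _)

namespace IsLocallyContractiveMean

variable (h : IsLocallyContractiveMean S ρ μ)
include h

theorem isTopologicalMean : IsTopologicalMean μ := ⟨h.isMean, h.nonexpansive.continuous⟩

theorem barycentric_mem {i : ι} {x : Fin (k + 1) → X} (hx : ∀ l, x l ∈ S i) (l : Fin (k + 1)) :
    barycentric μ x l ∈ S i :=
  h.convex i _ fun _ => hx _

theorem iterate_barycentric_mem {i : ι} {x : Fin (k + 1) → X} (hx : ∀ l, x l ∈ S i) (m : ℕ) :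
    ∀ l, (barycentric μ)^[m] x l ∈ S i := by
  induction m with
  | zero => exact hx
  | succ m ih =>
    rw [Function.iterate_succ_apply']
    exact h.barycentric_mem ih

/-- By symmetry the tuples with `x a` and with `x b` deleted may be arranged so as to differ in a
single coordinate, which holds `x b` in the one and `x a` in the other. -/
theorem dist_barycentric_apply_le {i : ι} {x : Fin (k + 1) → X} (hx : ∀ l, x l ∈ S i)
    (a b : Fin (k + 1)) :
    dist (barycentric μ x a) (barycentric μ x b) ≤ ρ i * dist (x a) (x b) := by
  rcases eq_or_ne a b with rfl | hab
  · simp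
  obtain ⟨j, hj⟩ := Fin.exists_succAbove_eq hab.symm
  set g : Fin k → Fin (k + 1) := Function.update a.succAbove j a with hg
  have hginj : Function.Injective g := by
    intro p q hpq
    by_cases hp : p = j <;> by_cases hq : q = j
    · rw [hp, hq]
    · subst hp
      simp only [hg, Function.update_self, Function.update_of_ne hq] at hpq
      exact absurd hpq.symm (Fin.succAbove_ne a q)
    · subst hq
      simp only [hg, Function.update_self, Function.update_of_ne hp] at hpq
      exact absurd hpq (Fin.succAbove_ne a p)
    · simp only [hg, Function.update_of_ne hp, Function.update_of_ne hq] at hpq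
      exact Fin.succAbove_right_injective hpq
  have hrange : Set.range b.succAbove = Set.range g := by
    rw [Fin.range_succAbove]
    ext c
    simp only [Set.mem_compl_iff, Set.mem_singleton_iff, Set.mem_range]
    constructor
    · intro hc
      rcases eq_or_ne c a with rfl | hca
      · exact ⟨j, by simp [hg]⟩
      · obtain ⟨p, hp⟩ := Fin.exists_succAbove_eq hca
        refine ⟨p, ?_⟩
        have hpj : p ≠ j := by
          rintro rfl
          exact hc (hp.symm.trans hj)
        simp [hg, Function.update_of_ne hpj, hp]
    · rintro ⟨p, rfl⟩ hp
      by_cases hpj : p = j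
      · subst hpj
        simp only [hg, Function.update_self] at hp
        exact hab hp
      · simp only [hg, Function.update_of_ne hpj] at hp
        exact hpj (Fin.succAbove_right_injective (hp.trans hj.symm))
  obtain ⟨σ, hσ⟩ := exists_perm_of_range_eq Fin.succAbove_right_injective hginj hrange
  have hb : barycentric μ x b = μ (fun l => x (g l)) := by
    rw [← h.symm σ, barycentric, hσ]
    rfl
  rw [hb]
  refine (h.contractive i _ _ j (fun l => hx _) (fun l => hx _) fun l hl => ?_).trans ?_
  · simp [hg, Function.update_of_ne hl]
  · simp only [hg, Function.update_self, hj, dist_comm (x b), le_refl]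

theorem dist_iterate_barycentric_apply_le {i : ι} (hρ : 0 ≤ ρ i) {x : Fin (k + 1) → X}
    (hx : ∀ l, x l ∈ S i) (a b : Fin (k + 1)) (m : ℕ) :
    dist ((barycentric μ)^[m] x a) ((barycentric μ)^[m] x b) ≤ ρ i ^ m * dist x (fun _ => x b) := by
  induction m with
  | zero => simpa using dist_le_pi_dist x (fun _ => x b) a
  | succ m ih =>
    rw [Function.iterate_succ_apply', pow_succ', mul_assoc]
    exact (h.dist_barycentric_apply_le (h.iterate_barycentric_mem hx m) a b).trans
      (mul_le_mul_of_nonneg_left ih hρ)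

/-- The iterates `β_μ^m x` form a Cauchy sequence because their diameter shrinks by the factor `ρ i`
in each step, and the shrinking diameter makes the limit constant. -/
theorem exists_tendsto_iterate_barycentric {i : ι} (hS : IsComplete (S i)) (hρ : 0 ≤ ρ i)
    (hρ1 : ρ i < 1) {x : Fin (k + 1) → X} (hx : ∀ l, x l ∈ S i) :
    ∃ p ∈ S i, Tendsto (fun m : ℕ => (barycentric μ)^[m] x) atTop (𝓝 fun _ => p) := by
  set C : ℝ := ∑ b, dist x (fun _ => x b) with hC
  have hle : ∀ a b m, dist ((barycentric μ)^[m] x a) ((barycentric μ)^[m] x b) ≤ C * ρ i ^ m := by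
    intro a b m
    rw [mul_comm]
    refine (h.dist_iterate_barycentric_apply_le hρ hx a b m).trans
      (mul_le_mul_of_nonneg_left ?_ (pow_nonneg hρ m))
    exact Finset.single_le_sum (f := fun b => dist x (fun _ => x b)) (fun _ _ => dist_nonneg)
      (Finset.mem_univ b)
  have hcau : CauchySeq fun m : ℕ => (barycentric μ)^[m] x 0 := by
    refine cauchySeq_of_le_geometric (ρ i) C hρ1 fun m => ?_
    rw [dist_comm, Function.iterate_succ_apply']
    exact (dist_le_pi_dist _ _ 0).trans
      (dist_barycentric_self_le h.isMean h.nonexpansive fun a b => hle a b m)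
  obtain ⟨p, hp, hlim⟩ := cauchySeq_tendsto_of_isComplete hS
    (fun m => h.iterate_barycentric_mem hx m 0) hcau
  refine ⟨p, hp, tendsto_pi_nhds.2 fun a => hlim.congr_dist ?_⟩
  refine squeeze_zero (fun _ => dist_nonneg) (fun m => hle 0 a m) ?_
  simpa using (tendsto_pow_atTop_nhds_zero_of_lt_one hρ hρ1).const_mul C

theorem iterate_barycentric_comp_perm (σ : Equiv.Perm (Fin (k + 1))) (x : Fin (k + 1) → X) (m : ℕ) :
    (barycentric μ)^[m] (x ∘ σ) = (barycentric μ)^[m] x ∘ σ := by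
  have hstep : ∀ y : Fin (k + 1) → X, barycentric μ (y ∘ σ) = barycentric μ y ∘ σ := by
    intro y
    funext a
    obtain ⟨τ, hτ⟩ := exists_perm_of_range_eq (f := σ ∘ a.succAbove) (g := (σ a).succAbove)
      (σ.injective.comp Fin.succAbove_right_injective) Fin.succAbove_right_injective (by
        rw [Set.range_comp, Fin.range_succAbove, Fin.range_succAbove, Set.image_compl_eq σ.bijective,
          Set.image_singleton])
    calc μ (y ∘ (σ ∘ a.succAbove)) = μ ((y ∘ (σ a).succAbove) ∘ τ) := by rw [hτ]; rfl
      _ = barycentric μ y (σ a) := h.symm τ _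
  induction m with
  | zero => rfl
  | succ m ih => rw [Function.iterate_succ_apply', Function.iterate_succ_apply', ih, hstep]

/-- Every property in `IsLocallyContractiveMean` passes to the limit defining the `β`-extension, with
the same contraction constants. -/
theorem exists_betaExtension (hS : ∀ i, IsComplete (S i)) (hρ : ∀ i, 0 ≤ ρ i) (hρ1 : ∀ i, ρ i < 1)
    (hcov : ∀ x : Fin (k + 1) → X, ∃ i, ∀ l, x l ∈ S i) :
    ∃ ν : (Fin (k + 1) → X) → X, IsLocallyContractiveMean S ρ ν ∧ IsBetaExtension μ ν := by
  have hex : ∀ x : Fin (k + 1) → X, ∃ p,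
      Tendsto (fun m : ℕ => (barycentric μ)^[m] x) atTop (𝓝 fun _ => p) := fun x => by
    obtain ⟨i, hi⟩ := hcov x
    obtain ⟨p, -, hp⟩ := h.exists_tendsto_iterate_barycentric (hS i) (hρ i) (hρ1 i) hi
    exact ⟨p, hp⟩
  choose ν hν using hex
  have huniq : ∀ {x : Fin (k + 1) → X} {p : X},
      Tendsto (fun m : ℕ => (barycentric μ)^[m] x) atTop (𝓝 fun _ => p) → ν x = p := fun {x p} hp =>
    congrFun (tendsto_nhds_unique (hν x) hp) 0
  have hmean : IsMean ν := fun a => huniq <| by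
    simp only [Function.iterate_fixed (h.isMean.barycentric_const a)]
    exact tendsto_const_nhds
  have hdist : ∀ x y : Fin (k + 1) → X, ∀ C, (∀ m : ℕ, dist ((barycentric μ)^[m + 1] x)
      ((barycentric μ)^[m + 1] y) ≤ C) → dist (ν x) (ν y) ≤ C := by
    intro x y C hC
    have hx := (tendsto_pi_nhds.1 (hν x) 0).comp (tendsto_add_atTop_nat 1)
    have hy := (tendsto_pi_nhds.1 (hν y) 0).comp (tendsto_add_atTop_nat 1)
    exact le_of_tendsto (hx.dist hy) (Eventually.of_forall fun m =>
      (dist_le_pi_dist _ _ 0).trans (hC m))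
  refine ⟨ν, ⟨hmean, fun x y => hdist x y _ fun m => h.nonexpansive.dist_iterate_barycentric_le x y _,
    fun σ x => huniq ?_, fun i x hx => ?_, fun i x y j hx hy hxy => ?_⟩,
    h.isTopologicalMean, hmean, hν⟩
  · refine tendsto_pi_nhds.2 fun a => ?_
    simp only [h.iterate_barycentric_comp_perm]
    exact tendsto_pi_nhds.1 (hν x) (σ a)
  · obtain ⟨p, hpS, hp⟩ := h.exists_tendsto_iterate_barycentric (hS i) (hρ i) (hρ1 i) hx
    rwa [huniq hp]
  · -- After one application of `β_μ` the two tuples are within `ρ i * dist (x j) (y j)`: in the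
    -- coordinate `j` they agree, in the others `μ` sees a change of one entry.
    have hC : 0 ≤ ρ i * dist (x j) (y j) := mul_nonneg (hρ i) dist_nonneg
    refine hdist x y _ fun m => ?_
    rw [Function.iterate_succ_apply, Function.iterate_succ_apply]
    refine (h.nonexpansive.dist_iterate_barycentric_le _ _ m).trans
      ((dist_pi_le_iff hC).2 fun a => ?_)
    rcases eq_or_ne j a with rfl | hja
    · have : barycentric μ x j = barycentric μ y j := by
        simp only [barycentric, fun l => hxy _ (Fin.succAbove_ne j l)]
      rw [this, dist_self]
      exact hC
    · obtain ⟨l, hl⟩ := Fin.exists_succAbove_eq hja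
      have := h.contractive i (fun l => x (a.succAbove l)) (fun l => y (a.succAbove l)) l
        (fun _ => hx _) (fun _ => hy _)
        (fun q hq => hxy _ fun hqj => hq (Fin.succAbove_right_injective (hqj.trans hl.symm)))
      simpa only [hl, barycentric] using this

theorem inductivelyBetaExtends [Nonempty X] (hS : ∀ i, IsComplete (S i)) (hρ : ∀ i, 0 ≤ ρ i)
    (hρ1 : ∀ i, ρ i < 1) (hcov : ∀ (n : ℕ) (x : Fin n → X), ∃ i, ∀ l, x l ∈ S i) :
    InductivelyBetaExtends μ := by
  classical
  let M : ℕ → Type _ := fun n => {ν : (Fin n → X) → X // IsLocallyContractiveMean S ρ ν}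
  have hstep : ∀ n (ν : M n), ∃ ν' : M (n + 1), IsBetaExtension ν.1 ν'.1 := fun n ν => by
    obtain ⟨ν', h1, h2⟩ := ν.2.exists_betaExtension hS hρ hρ1 (hcov _)
    exact ⟨⟨ν', h1⟩, h2⟩
  choose next hnext using hstep
  let ν : ∀ n, k ≤ n → M n := fun n hn =>
    Nat.leRec (motive := fun m _ => M m) ⟨μ, h⟩ (fun m _ a => next m a) hn
  refine ⟨fun n => if hn : k ≤ n then (ν n hn).1 else fun _ => Classical.arbitrary X, ?_, ?_⟩
  · simp [ν]
  · intro n hn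
    have hsucc : ν (n + 1) (hn.trans n.le_succ) = next n (ν n hn) := Nat.leRec_succ _ _ hn
    simp only [dif_pos hn, dif_pos (hn.trans n.le_succ)]
    rw [hsucc]
    exact ⟨(ν n hn).2.isTopologicalMean, hnext n _⟩

end IsLocallyContractiveMean

end Extension

/-! ### The integral representation of the logarithmic mean -/

section Integral

open MeasureTheory
open scoped Ring

/-- `∫₀¹ dt / ((1 - t) + t x) = log x / (x - 1)`, with value `1` at `x = 1`. -/
theorem setIntegral_inv_segment_eq_inv_logRep {x : ℝ} (hx : 0 < x) :
    ∫ t in Set.Icc (0 : ℝ) 1, ((1 - t) + t * x)⁻¹ = (logRep x)⁻¹ := by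
  rw [integral_Icc_eq_integral_Ioc, ← intervalIntegral.integral_of_le zero_le_one, logRep,
    realLogMean]
  split_ifs with h
  · subst h
    simp
  · have hx1 : x - 1 ≠ 0 := sub_ne_zero.2 (Ne.symm h)
    have h1 : (∫ t in (0 : ℝ)..1, ((1 - t) + t * x)⁻¹) =
        ∫ t in (0 : ℝ)..1, (fun y : ℝ => y⁻¹) ((x - 1) * t + 1) := by
      congr 1
      ext t
      congr 1
      ring
    rw [h1, intervalIntegral.integral_comp_mul_add _ hx1]
    simp only [mul_zero, zero_add, mul_one, sub_add_cancel]
    rw [integral_inv_of_pos one_pos hx, div_one, Real.log_one, sub_zero, inv_div, smul_eq_mul,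
      div_eq_inv_mul]

variable {A : Type*} [CStarAlgebra A]

/-- `∫₀¹ ((1 - t) a + t b)⁻¹ dt`, which is the inverse of the logarithmic mean of strictly positive
`a` and `b`. -/
noncomputable def invLogMean (a b : A) : A :=
  ∫ t in Set.Icc (0 : ℝ) 1, ((1 - t) • a + t • b)⁻¹ʳ

theorem ringInverse_smul {c : ℝ} (hc : c ≠ 0) (a : A) : (c • a)⁻¹ʳ = c⁻¹ • a⁻¹ʳ := by
  have hu : IsUnit (c • (1 : A)) := isUnit_one.smul (Units.mk0 c hc)
  have h1 : (c • (1 : A))⁻¹ʳ = c⁻¹ • 1 := by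
    rw [← mul_one (c • (1 : A))⁻¹ʳ, Ring.inverse_mul_eq_iff_eq_mul _ _ _ hu]
    simp [smul_smul, hc]
  rw [← smul_one_mul c a, Ring.inverse_mul (Or.inl hu), h1, mul_smul_comm, mul_one]

theorem invLogMean_comm (a b : A) : invLogMean a b = invLogMean b a := by
  simp only [invLogMean, integral_Icc_eq_integral_Ioc,
    ← intervalIntegral.integral_of_le (zero_le_one (α := ℝ))]
  have h := intervalIntegral.integral_comp_sub_left (a := 0) (b := 1)
    (fun t : ℝ => ((1 - t) • a + t • b)⁻¹ʳ) 1
  simp only [sub_sub_cancel, sub_self, sub_zero] at h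
  rw [← h]
  simp only [add_comm]

theorem invLogMean_smul {c : ℝ} (hc : c ≠ 0) (a b : A) :
    invLogMean (c • a) (c • b) = c⁻¹ • invLogMean a b := by
  rw [invLogMean, invLogMean, ← integral_smul]
  congr 1
  ext t
  rw [← ringInverse_smul hc, smul_add, smul_comm c, smul_comm c]

theorem invLogMean_self (a : A) : invLogMean a a = a⁻¹ʳ := by
  simp [invLogMean, ← add_smul]

variable [PartialOrder A] [StarOrderedRing A]

theorem isStrictlyPositive_segment {a b : A} (ha : IsStrictlyPositive a)
    (hb : IsStrictlyPositive b) {t : ℝ} (ht : t ∈ Set.Icc (0 : ℝ) 1) :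
    IsStrictlyPositive ((1 - t) • a + t • b) := by
  rcases ht.1.eq_or_lt with rfl | h
  · simpa using ha
  · exact isStrictlyPositive_add (Or.inr ⟨smul_nonneg (sub_nonneg.2 ht.2) ha.nonneg,
      IsStrictlyPositive.smul h hb⟩)

theorem continuousOn_ringInverse_segment {a b : A} (ha : IsStrictlyPositive a)
    (hb : IsStrictlyPositive b) :
    ContinuousOn (fun t : ℝ => ((1 - t) • a + t • b)⁻¹ʳ) (Set.Icc 0 1) := by
  intro t ht
  obtain ⟨u, hu⟩ := (isStrictlyPositive_segment ha hb ht).isUnit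
  have h1 : ContinuousAt (fun t : ℝ => (1 - t) • a + t • b) t := by fun_prop
  have h2 : ContinuousAt Ring.inverse ((1 - t) • a + t • b) := hu ▸ NormedRing.inverse_continuousAt u
  exact (ContinuousAt.comp (f := fun t : ℝ => (1 - t) • a + t • b) h2 h1).continuousWithinAt

theorem integrableOn_ringInverse_segment {a b : A} (ha : IsStrictlyPositive a)
    (hb : IsStrictlyPositive b) :
    IntegrableOn (fun t : ℝ => ((1 - t) • a + t • b)⁻¹ʳ) (Set.Icc 0 1) :=
  (continuousOn_ringInverse_segment ha hb).integrableOn_compact isCompact_Icc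

theorem invLogMean_anti {a a' b b' : A} (ha : IsStrictlyPositive a) (hb : IsStrictlyPositive b)
    (haa : a ≤ a') (hbb : b ≤ b') : invLogMean a' b' ≤ invLogMean a b := by
  refine setIntegral_mono_on (integrableOn_ringInverse_segment (ha.of_le haa) (hb.of_le hbb))
    (integrableOn_ringInverse_segment ha hb) measurableSet_Icc fun t ht => ?_
  refine CStarAlgebra.ringInverse_le_ringInverse ?_ (isStrictlyPositive_segment ha hb ht)
  exact add_le_add (smul_le_smul_of_nonneg_left haa (sub_nonneg.2 ht.2))
    (smul_le_smul_of_nonneg_left hbb ht.1)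

/-- Congruence by a strictly positive element turns the inverse of the mean into its congruence by
the inverse element. -/
theorem invLogMean_conjugate {p a b : A} (hp : IsUnit p) (ha : IsStrictlyPositive a)
    (hb : IsStrictlyPositive b) :
    invLogMean (p * a * p) (p * b * p) = p⁻¹ʳ * invLogMean a b * p⁻¹ʳ := by
  have hint := integrableOn_ringInverse_segment ha hb
  have hint' : IntegrableOn (fun t : ℝ => p⁻¹ʳ * ((1 - t) • a + t • b)⁻¹ʳ) (Set.Icc 0 1) :=
    hint.const_mul' _
  rw [invLogMean, invLogMean, ← integral_const_mul_of_integrable hint,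
    ← integral_mul_const_of_integrable hint']
  congr 1
  ext t
  have : (1 - t) • (p * a * p) + t • (p * b * p) = p * ((1 - t) • a + t • b) * p := by
    simp only [mul_add, add_mul, mul_smul_comm, smul_mul_assoc]
  rw [this, Ring.inverse_mul (Or.inr hp), Ring.inverse_mul (Or.inl hp), mul_assoc]

theorem ringInverse_cfc_logRep {c : A} (hc : IsStrictlyPositive c) :
    (cfc logRep c)⁻¹ʳ = invLogMean 1 c := by
  have hsp : ∀ x ∈ spectrum ℝ c, 0 < x := fun x hx => hc.spectrum_pos hx
  have hsa : IsSelfAdjoint c := hc.isSelfAdjoint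
  have hden : ∀ t ∈ Set.Icc (0 : ℝ) 1, ∀ x ∈ spectrum ℝ c, 0 < (1 - t) + t * x := by
    intro t ht x hx
    rcases ht.1.eq_or_lt with rfl | h
    · simp
    · exact add_pos_of_nonneg_of_pos (sub_nonneg.2 ht.2) (mul_pos h (hsp x hx))
  have hcont : ContinuousOn (Function.uncurry fun t x : ℝ => ((1 - t) + t * x)⁻¹)
      (Set.Icc (0 : ℝ) 1 ×ˢ spectrum ℝ c) :=
    ContinuousOn.inv₀ (by fun_prop) fun p hp => (hden p.1 hp.1 p.2 hp.2).ne'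
  obtain ⟨C, hC⟩ := (isCompact_Icc.prod (spectrum.isCompact c)).exists_bound_of_continuousOn hcont
  rw [← cfc_inv logRep c (fun x hx => (logRep_pos (hsp x hx)).ne') (continuousOn_logRep.mono hsp) hsa,
    cfc_congr fun x hx => (setIntegral_inv_segment_eq_inv_logRep (hsp x hx)).symm,
    cfc_setIntegral measurableSet_Icc _ (fun _ => C) c hcont
      (ae_restrict_of_forall_mem measurableSet_Icc fun t ht x hx => hC (t, x) ⟨ht, hx⟩)
      (integrable_const C).hasFiniteIntegral hsa, invLogMean]
  refine setIntegral_congr_fun measurableSet_Icc fun t ht => ?_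
  rw [cfc_inv (fun x : ℝ => (1 - t) + t * x) c (fun x hx => (hden t ht x hx).ne') (by fun_prop) hsa,
    cfc_const_add _ _ c (by fun_prop) hsa, cfc_const_mul_id _ c hsa, Algebra.algebraMap_eq_smul_one]

variable {E : Type*} [NormedAddCommGroup E] [InnerProductSpace ℂ E] [CompleteSpace E]

theorem ringInverse_perspective_logRep (a b : PosOp E) :
    (perspective logRep a.op b.op)⁻¹ʳ = invLogMean a.op b.op := by
  have ha := a.isStrictlyPositive
  have hp : ∀ r : ℝ, IsStrictlyPositive (a.op ^ r) := fun r => IsStrictlyPositive.rpow _ _ ha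
  have hc : IsStrictlyPositive (a.op ^ (-(1 / 2) : ℝ) * b.op * a.op ^ (-(1 / 2) : ℝ)) :=
    IsStrictlyPositive.conjugate_of_isUnit_of_isSelfAdjoint _ _ (hp _).isUnit (hp _).isSelfAdjoint
      b.isStrictlyPositive
  have h1 : a.op ^ (1 / 2 : ℝ) * a.op ^ (-(1 / 2) : ℝ) = 1 := CFC.rpow_mul_rpow_neg _ ha
  have h2 : a.op ^ (-(1 / 2) : ℝ) * a.op ^ (1 / 2 : ℝ) = 1 := CFC.rpow_neg_mul_rpow _ ha
  have haa : a.op ^ (1 / 2 : ℝ) * 1 * a.op ^ (1 / 2 : ℝ) = a.op := by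
    rw [mul_one, ← CFC.rpow_add ha.isUnit, add_halves, CFC.rpow_one _ ha.nonneg]
  have hbb : a.op ^ (1 / 2 : ℝ) * (a.op ^ (-(1 / 2) : ℝ) * b.op * a.op ^ (-(1 / 2) : ℝ)) *
      a.op ^ (1 / 2 : ℝ) = b.op := by
    rw [mul_assoc _ b.op, ← mul_assoc, h1, one_mul, mul_assoc, h2, mul_one]
  have hu := (hp (1 / 2)).isUnit
  rw [perspective, Ring.inverse_mul (Or.inr hu), Ring.inverse_mul (Or.inl hu),
    ringInverse_cfc_logRep hc, ← mul_assoc, ← invLogMean_conjugate hu isStrictlyPositive_one hc, haa,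
    hbb]

theorem opLogMean_op (a b : PosOp E) : (opLogMean a b).op = (invLogMean a.op b.op)⁻¹ʳ := by
  rw [← ringInverse_perspective_logRep]
  exact (Ring.inverse_inverse (opLogMean a b).isStrictlyPositive.isUnit).symm

theorem isStrictlyPositive_invLogMean (a b : PosOp E) :
    IsStrictlyPositive (invLogMean a.op b.op) := by
  rw [← ringInverse_perspective_logRep]
  exact (opLogMean a b).isStrictlyPositive.ringInverse

end Integral

/-! ### A quantitative monotonicity estimate -/

section Estimate

open MeasureTheory
open scoped Ring

variable {A : Type*} [CStarAlgebra A] [PartialOrder A] [StarOrderedRing A]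

theorem isStrictlyPositive_of_inv_smul_one_le {a : A} {N : ℝ} (hN : 0 < N)
    (h : N⁻¹ • (1 : A) ≤ a) : IsStrictlyPositive a :=
  (IsStrictlyPositive.smul (inv_pos.2 hN) isStrictlyPositive_one).of_le h

/-- Shrinking the first argument by the factor `s` enlarges the inverse mean by a factor
`1 + c (1 - s)`, where `c > 0` depends only on the bounds of `a` and `b`. -/
theorem one_add_smul_invLogMean_le {a b : A} {N s : ℝ} (hN : 1 ≤ N) (hs : 0 < s) (hs1 : s ≤ 1)
    (ha : N⁻¹ • (1 : A) ≤ a) (ha' : a ≤ N • 1) (hb : N⁻¹ • (1 : A) ≤ b) (hb' : b ≤ N • 1) :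
    (1 + (1 - s) * (N⁻¹ ^ 4 / 2)) • invLogMean a b ≤ invLogMean (s • a) b := by
  have hN0 : 0 < N := one_pos.trans_le hN
  have hNi : 0 < N⁻¹ := inv_pos.2 hN0
  have hNi1 : N⁻¹ ≤ 1 := inv_le_one_of_one_le₀ hN
  have hap := isStrictlyPositive_of_inv_smul_one_le hN0 ha
  have hbp := isStrictlyPositive_of_inv_smul_one_le hN0 hb
  have hsap : IsStrictlyPositive (s • a) := IsStrictlyPositive.smul hs hap
  have hone : IsStrictlyPositive (N⁻¹ • (1 : A)) := isStrictlyPositive_one.smul hNi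
  have hJ : N⁻¹ ^ 2 • invLogMean a b ≤ N⁻¹ • (1 : A) := by
    have h1 : invLogMean a b ≤ N • (1 : A) := by
      refine (invLogMean_anti hone hone ha hb).trans (le_of_eq ?_)
      rw [invLogMean_self, ringInverse_smul hNi.ne', Ring.inverse_one, inv_inv]
    refine (smul_le_smul_of_nonneg_left h1 (by positivity)).trans (le_of_eq ?_)
    rw [smul_smul]
    congr 1
    field_simp
  set d : ℝ := (1 - s) * N⁻¹ ^ 3 with hd
  have hd0 : 0 ≤ d := mul_nonneg (sub_nonneg.2 hs1) (by positivity)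
  have hpt : ∀ t ∈ Set.Icc (0 : ℝ) 1, ((1 - t) • a + t • b)⁻¹ʳ + (d * (1 - t)) • (1 : A) ≤
      ((1 - t) • (s • a) + t • b)⁻¹ʳ := by
    intro t ht
    have ht1 : 0 ≤ 1 - t := sub_nonneg.2 ht.2
    have hs1' : 0 ≤ 1 - s := sub_nonneg.2 hs1
    set x : A := (1 - t) • a + t • b with hx
    have hxp : IsStrictlyPositive x := isStrictlyPositive_segment hap hbp ht
    have hxN : x ≤ N • (1 : A) := by
      calc x ≤ (1 - t) • (N • (1 : A)) + t • (N • (1 : A)) :=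
            add_le_add (smul_le_smul_of_nonneg_left ha' ht1) (smul_le_smul_of_nonneg_left hb' ht.1)
        _ = N • 1 := by rw [← add_smul, sub_add_cancel, one_smul]
    have hxi : N⁻¹ • (1 : A) ≤ x⁻¹ʳ := by
      have := CStarAlgebra.ringInverse_le_ringInverse hxN hxp
      rwa [ringInverse_smul hN0.ne', Ring.inverse_one] at this
    have hxa : N⁻¹ ^ 2 • x ≤ a := by
      refine le_trans ?_ ha
      refine (smul_le_smul_of_nonneg_left hxN (by positivity)).trans (le_of_eq ?_)
      rw [smul_smul]
      congr 1
      field_simp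
    -- the segment for `s • a` falls below `x` by at least the fraction `q`
    set q : ℝ := (1 - s) * (1 - t) * N⁻¹ ^ 2 with hq
    have hq0 : 0 ≤ q := by positivity
    have hq1 : q < 1 := by
      have h1 : (1 - s) * (1 - t) ≤ (1 - s) * 1 :=
        mul_le_mul_of_nonneg_left (by linarith [ht.1]) hs1'
      have h2 : N⁻¹ ^ 2 ≤ 1 := pow_le_one₀ hNi.le hNi1
      have h3 : q ≤ (1 - s) * (1 - t) * 1 :=
        mul_le_mul_of_nonneg_left h2 (mul_nonneg hs1' ht1)
      linarith
    have hle : (1 - t) • (s • a) + t • b ≤ (1 - q) • x := by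
      have h1 : (1 - t) • (s • a) + t • b = x - ((1 - s) * (1 - t)) • a := by
        rw [hx]
        module
      have h2 : ((1 - s) * (1 - t)) • (N⁻¹ ^ 2 • x) ≤ ((1 - s) * (1 - t)) • a :=
        smul_le_smul_of_nonneg_left hxa (mul_nonneg hs1' ht1)
      rw [h1, sub_smul, one_smul, hq, mul_smul _ (N⁻¹ ^ 2)]
      exact sub_le_sub_left h2 x
    have hinv : (1 - q)⁻¹ • x⁻¹ʳ ≤ ((1 - t) • (s • a) + t • b)⁻¹ʳ := by
      rw [← ringInverse_smul (sub_pos.2 hq1).ne']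
      exact CStarAlgebra.ringInverse_le_ringInverse hle (isStrictlyPositive_segment hsap hbp ht)
    have hgeom : 1 + q ≤ (1 - q)⁻¹ := by
      rw [le_inv_comm₀ (by linarith) (sub_pos.2 hq1), inv_eq_one_div, le_div_iff₀ (by linarith)]
      nlinarith
    calc x⁻¹ʳ + (d * (1 - t)) • (1 : A) = x⁻¹ʳ + q • (N⁻¹ • (1 : A)) := by
          rw [smul_smul]
          congr 2
          rw [hd, hq]
          ring
      _ ≤ x⁻¹ʳ + q • x⁻¹ʳ := add_le_add_right (smul_le_smul_of_nonneg_left hxi hq0) _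
      _ = (1 + q) • x⁻¹ʳ := by rw [add_smul, one_smul]
      _ ≤ (1 - q)⁻¹ • x⁻¹ʳ := smul_le_smul_of_nonneg_right hgeom hxp.ringInverse.nonneg
      _ ≤ _ := hinv
  have hint1 := integrableOn_ringInverse_segment hap hbp
  have hint2 : IntegrableOn (fun t : ℝ => (d * (1 - t)) • (1 : A)) (Set.Icc 0 1) :=
    (Continuous.continuousOn (by fun_prop)).integrableOn_compact isCompact_Icc
  have hreal : ∫ t in Set.Icc (0 : ℝ) 1, d * (1 - t) = d / 2 := by
    rw [integral_Icc_eq_integral_Ioc, ← intervalIntegral.integral_of_le zero_le_one,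
      intervalIntegral.integral_const_mul, intervalIntegral.integral_sub (by simp) (by simp)]
    simp
    ring
  calc (1 + (1 - s) * (N⁻¹ ^ 4 / 2)) • invLogMean a b
        = invLogMean a b + ((1 - s) * N⁻¹ ^ 2 / 2) • (N⁻¹ ^ 2 • invLogMean a b) := by
          rw [add_smul, one_smul, smul_smul]
          congr 2
          ring
    _ ≤ invLogMean a b + ((1 - s) * N⁻¹ ^ 2 / 2) • (N⁻¹ • (1 : A)) :=
        add_le_add_right (smul_le_smul_of_nonneg_left hJ
          (div_nonneg (mul_nonneg (sub_nonneg.2 hs1) (by positivity)) zero_le_two)) _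
    _ = ∫ t in Set.Icc (0 : ℝ) 1, (((1 - t) • a + t • b)⁻¹ʳ + (d * (1 - t)) • (1 : A)) := by
        rw [integral_add hint1 hint2, integral_smul_const, hreal, smul_smul, invLogMean]
        congr 2
        rw [hd]
        ring
    _ ≤ invLogMean (s • a) b :=
        setIntegral_mono_on (hint1.add hint2) (integrableOn_ringInverse_segment hsap hbp)
          measurableSet_Icc hpt

end Estimate

/-! ### The Thompson metric and its completeness on order intervals -/

section Metric

variable {E : Type*} [NormedAddCommGroup E] [InnerProductSpace ℂ E] [CompleteSpace E]

theorem log_thompsonM_le_iff [Nontrivial (E →L[ℂ] E)] {A B : PosOp E} {r : ℝ} :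
    Real.log (thompsonM A B) ≤ r ↔ A.op ≤ Real.exp r • B.op := by
  rw [Real.log_le_iff_le_exp (thompsonM_pos A B)]
  exact ⟨fun h => (le_thompsonM_smul A B).trans
    (smul_le_smul_of_nonneg_right h B.isStrictlyPositive.nonneg), thompsonM_le (Real.exp_pos r)⟩

/-- The condition `0 ≤ r` matters only for `E = 0`, where both inequalities on the right always
hold. -/
theorem PosOp.dist_le_iff {A B : PosOp E} {r : ℝ} (hr : 0 ≤ r) :
    dist A B ≤ r ↔ A.op ≤ Real.exp r • B.op ∧ B.op ≤ Real.exp r • A.op := by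
  change thompsonDist A B ≤ r ↔ _
  rcases subsingleton_or_nontrivial (E →L[ℂ] E) with h | h
  · simp only [thompsonDist_of_subsingleton, hr, true_iff]
    exact ⟨le_of_eq (Subsingleton.elim _ _), le_of_eq (Subsingleton.elim _ _)⟩
  · rw [thompsonDist, max_le_iff, log_thompsonM_le_iff, log_thompsonM_le_iff]

theorem PosOp.op_le_exp_dist_smul (A B : PosOp E) : A.op ≤ Real.exp (dist A B) • B.op :=
  ((PosOp.dist_le_iff dist_nonneg).1 le_rfl).1

theorem norm_op_le_of_mem_orderInterval {n : ℕ} {A : PosOp E} (hA : A ∈ orderInterval E n) :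
    ‖A.op‖ ≤ n := by
  rw [CStarAlgebra.norm_le_iff_le_algebraMap _ n.cast_nonneg A.isStrictlyPositive.nonneg,
    Algebra.algebraMap_eq_smul_one]
  exact hA.2

theorem norm_op_sub_op_le (A B : PosOp E) :
    ‖A.op - B.op‖ ≤ (2 * Real.exp (dist A B) - Real.exp (-dist A B) - 1) * ‖B.op‖ := by
  set r := dist A B with hr
  have hr0 : 0 ≤ r := dist_nonneg
  have h1 : A.op ≤ Real.exp r • B.op := A.op_le_exp_dist_smul B
  have h2 : Real.exp (-r) • B.op ≤ A.op := by
    have h := smul_le_smul_of_nonneg_left (B.op_le_exp_dist_smul A) (Real.exp_pos (-r)).le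
    rwa [dist_comm B A, ← hr, smul_smul, ← Real.exp_add, neg_add_cancel, Real.exp_zero,
      one_smul] at h
  have h3 : ‖Real.exp r • B.op - A.op‖ ≤ (Real.exp r - Real.exp (-r)) * ‖B.op‖ := by
    have h := CStarAlgebra.norm_le_norm_of_nonneg_of_le (sub_nonneg.2 h1)
      (sub_le_sub_left h2 (Real.exp r • B.op))
    rwa [← sub_smul, norm_smul, Real.norm_of_nonneg
      (sub_nonneg.2 (Real.exp_le_exp.2 (by linarith)))] at h
  have h4 : ‖(Real.exp r - 1) • B.op‖ = (Real.exp r - 1) * ‖B.op‖ := by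
    rw [norm_smul, Real.norm_of_nonneg (sub_nonneg.2 (Real.one_le_exp hr0))]
  calc ‖A.op - B.op‖ = ‖(Real.exp r - 1) • B.op - (Real.exp r • B.op - A.op)‖ := by
        congr 1
        module
    _ ≤ (Real.exp r - 1) * ‖B.op‖ + (Real.exp r - Real.exp (-r)) * ‖B.op‖ := by
        refine (norm_sub_le _ _).trans ?_
        rw [h4]
        linarith
    _ = _ := by ring

/-- A Thompson–Cauchy sequence in the interval is norm-Cauchy; its norm limit stays in the interval,
hence is invertible, and is the Thompson limit because the Loewner order is norm-closed. -/
theorem isComplete_orderInterval {n : ℕ} (hn : 1 ≤ n) : IsComplete (orderInterval E n) := by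
  have hn0 : (0 : ℝ) < n := by exact_mod_cast hn
  rw [← completeSpace_coe_iff_isComplete]
  refine Metric.complete_of_cauchySeq_tendsto fun u hu => ?_
  have hcau : CauchySeq fun m => (u m : PosOp E).op := by
    rw [cauchySeq_iff_tendsto_dist_atTop_0] at hu ⊢
    have hg : Continuous fun r : ℝ => (2 * Real.exp r - Real.exp (-r) - 1) * (n : ℝ) := by fun_prop
    have hlim := (hg.tendsto 0).comp hu
    simp only [Real.exp_zero, neg_zero] at hlim
    norm_num at hlim
    refine squeeze_zero (fun _ => dist_nonneg) (fun p => ?_) hlim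
    rw [dist_eq_norm]
    refine (norm_op_sub_op_le _ _).trans
      (mul_le_mul_of_nonneg_left (norm_op_le_of_mem_orderInterval (u p.2).2) ?_)
    have h0 : 0 ≤ dist (u p.1 : PosOp E) (u p.2) := dist_nonneg
    have h1 := Real.one_le_exp h0
    have h2 := Real.exp_le_one_iff.2 (neg_nonpos.2 h0)
    linarith
  obtain ⟨a, ha⟩ := cauchySeq_tendsto_of_complete hcau
  have hlow : (1 / (n : ℝ)) • (1 : E →L[ℂ] E) ≤ a :=
    ge_of_tendsto ha (Eventually.of_forall fun m => (u m).2.1)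
  have hup : a ≤ (n : ℝ) • (1 : E →L[ℂ] E) :=
    le_of_tendsto ha (Eventually.of_forall fun m => (u m).2.2)
  have hpos : IsStrictlyPositive a :=
    isStrictlyPositive_of_inv_smul_one_le hn0 (by rwa [← one_div])
  refine ⟨⟨⟨a, hpos⟩, hlow, hup⟩, Metric.tendsto_atTop.2 fun ε hε => ?_⟩
  obtain ⟨N, hN⟩ := Metric.cauchySeq_iff.1 hu (ε / 2) (half_pos hε)
  refine ⟨N, fun m hm => lt_of_le_of_lt ?_ (half_lt_self hε)⟩
  have hml : ∀ᶠ l in atTop, (u m : PosOp E).op ≤ Real.exp (ε / 2) • (u l : PosOp E).op ∧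
      (u l : PosOp E).op ≤ Real.exp (ε / 2) • (u m : PosOp E).op := by
    filter_upwards [eventually_ge_atTop N] with l hl
    exact (PosOp.dist_le_iff (half_pos hε).le).1 (hN m hm l hl).le
  exact (PosOp.dist_le_iff (half_pos hε).le).2
    ⟨ge_of_tendsto (ha.const_smul _) (hml.mono fun _ h => h.1),
      le_of_tendsto ha (hml.mono fun _ h => h.2)⟩

theorem orderInterval_mono {m n : ℕ} (hm : 1 ≤ m) (hmn : m ≤ n) :
    orderInterval E m ⊆ orderInterval E n := by
  have hm0 : (0 : ℝ) < m := by exact_mod_cast hm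
  have hmn' : (m : ℝ) ≤ n := by exact_mod_cast hmn
  have h1 : (0 : E →L[ℂ] E) ≤ 1 := isStrictlyPositive_one.nonneg
  exact fun A hA =>
    ⟨(smul_le_smul_of_nonneg_right (one_div_le_one_div_of_le hm0 hmn') h1).trans hA.1,
      hA.2.trans (smul_le_smul_of_nonneg_right hmn' h1)⟩

theorem exists_mem_orderInterval (A : PosOp E) : ∃ n : ℕ, A ∈ orderInterval E (n + 1) := by
  let I : PosOp E := ⟨1, isStrictlyPositive_one⟩
  obtain ⟨l, hl, hl'⟩ := exists_le_smul A I
  obtain ⟨r, hr, hr'⟩ := exists_le_smul I A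
  have h1 : (0 : E →L[ℂ] E) ≤ 1 := isStrictlyPositive_one.nonneg
  obtain ⟨n, hn⟩ := exists_nat_ge (max l r)
  have hln : l ≤ (n + 1 : ℕ) := by push_cast; linarith [le_max_left l r]
  have hrn : r ≤ (n + 1 : ℕ) := by push_cast; linarith [le_max_right l r]
  have hn0 : (0 : ℝ) < (n + 1 : ℕ) := by positivity
  refine ⟨n, ?_, hl'.trans (smul_le_smul_of_nonneg_right hln h1)⟩
  have h2 : (1 : E →L[ℂ] E) ≤ ((n + 1 : ℕ) : ℝ) • A.op :=
    hr'.trans (smul_le_smul_of_nonneg_right hrn A.isStrictlyPositive.nonneg)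
  have h3 := smul_le_smul_of_nonneg_left h2 (one_div_pos.2 hn0).le
  rwa [smul_smul, one_div_mul_cancel hn0.ne', one_smul] at h3

theorem exists_forall_mem_orderInterval {k : ℕ} (x : Fin k → PosOp E) :
    ∃ n : ℕ, ∀ l, x l ∈ orderInterval E (n + 1) := by
  choose f hf using fun l => exists_mem_orderInterval (x l)
  exact ⟨Finset.univ.sup f, fun l => orderInterval_mono (Nat.succ_le_succ (Nat.zero_le _))
    (Nat.succ_le_succ (Finset.le_sup (f := f) (Finset.mem_univ l))) (hf l)⟩

theorem dist_le_of_mem_orderInterval {n : ℕ} (hn : 1 ≤ n) {A B : PosOp E}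
    (hA : A ∈ orderInterval E n) (hB : B ∈ orderInterval E n) :
    dist A B ≤ Real.log ((n : ℝ) ^ 2) := by
  have hn1 : (1 : ℝ) ≤ n := by exact_mod_cast hn
  have hn0 : (0 : ℝ) < n := one_pos.trans_le hn1
  have key : ∀ {A B : PosOp E}, A ∈ orderInterval E n → B ∈ orderInterval E n →
      A.op ≤ ((n : ℝ) ^ 2) • B.op := fun {A B} hA hB => by
    have h := smul_le_smul_of_nonneg_left hB.1 (sq_nonneg (n : ℝ))
    rw [smul_smul, show (n : ℝ) ^ 2 * (1 / n) = n by field_simp] at h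
    exact hA.2.trans h
  rw [PosOp.dist_le_iff (Real.log_nonneg (one_le_pow₀ hn1)), Real.exp_log (by positivity)]
  exact ⟨key hA hB, key hB hA⟩

end Metric

/-! ### Contractivity of the logarithmic mean -/

section Contraction

open scoped Ring

variable {E : Type*} [NormedAddCommGroup E] [InnerProductSpace ℂ E] [CompleteSpace E]

theorem opLogMean_comm (A B : PosOp E) : opLogMean A B = opLogMean B A :=
  PosOp.ext (by rw [opLogMean_op, opLogMean_op, invLogMean_comm])

theorem opLogMean_self (A : PosOp E) : opLogMean A A = A :=
  PosOp.ext (by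
    rw [opLogMean_op, invLogMean_self, Ring.inverse_inverse A.isStrictlyPositive.isUnit])

theorem opLogMean_le_smul {A B A' B' : PosOp E} {c : ℝ} (hc : 0 < c)
    (h : c⁻¹ • invLogMean A'.op B'.op ≤ invLogMean A.op B.op) :
    (opLogMean A B).op ≤ c • (opLogMean A' B').op := by
  have h1 := CStarAlgebra.ringInverse_le_ringInverse h
    (IsStrictlyPositive.smul (inv_pos.2 hc) (isStrictlyPositive_invLogMean A' B'))
  rwa [ringInverse_smul (inv_pos.2 hc).ne', inv_inv, ← opLogMean_op, ← opLogMean_op] at h1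

/-- The logarithmic mean is monotone and homogeneous. -/
theorem opLogMean_le_smul_of_le {A B A' B' : PosOp E} {c : ℝ} (hc : 0 < c)
    (hA : A.op ≤ c • A'.op) (hB : B.op ≤ c • B'.op) :
    (opLogMean A B).op ≤ c • (opLogMean A' B').op := by
  refine opLogMean_le_smul hc ?_
  rw [← invLogMean_smul hc.ne']
  exact invLogMean_anti A.isStrictlyPositive B.isStrictlyPositive hA hB

theorem dist_opLogMean_le (A B A' B' : PosOp E) :
    dist (opLogMean A B) (opLogMean A' B') ≤ max (dist A A') (dist B B') := by
  have h0 : 0 ≤ max (dist A A') (dist B B') := dist_nonneg.trans (le_max_left _ _)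
  have hA := (PosOp.dist_le_iff h0).1 (le_max_left (dist A A') (dist B B'))
  have hB := (PosOp.dist_le_iff h0).1 (le_max_right (dist A A') (dist B B'))
  exact (PosOp.dist_le_iff h0).2 ⟨opLogMean_le_smul_of_le (Real.exp_pos _) hA.1 hB.1,
    opLogMean_le_smul_of_le (Real.exp_pos _) hA.2 hB.2⟩

theorem opLogMean_mem_orderInterval {n : ℕ} (hn : 1 ≤ n) {A B : PosOp E}
    (hA : A ∈ orderInterval E n) (hB : B ∈ orderInterval E n) :
    opLogMean A B ∈ orderInterval E n := by
  have hn0 : (0 : ℝ) < n := by exact_mod_cast hn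
  let I : PosOp E := ⟨1, isStrictlyPositive_one⟩
  have hI : (opLogMean I I).op = 1 := by rw [opLogMean_self]
  constructor
  · have key : ∀ {C : PosOp E}, C ∈ orderInterval E n → I.op ≤ (n : ℝ) • C.op := fun {C} hC => by
      have h := smul_le_smul_of_nonneg_left hC.1 hn0.le
      rwa [smul_smul, mul_one_div_cancel hn0.ne', one_smul] at h
    have h := smul_le_smul_of_nonneg_left (opLogMean_le_smul_of_le hn0 (key hA) (key hB))
      (one_div_pos.2 hn0).le
    rwa [hI, smul_smul, one_div_mul_cancel hn0.ne', one_smul] at h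
  · have h := opLogMean_le_smul_of_le (A' := I) (B' := I) hn0 hA.2 hB.2
    rwa [hI] at h

/-- A contraction constant of the logarithmic mean on `[(1/n) I, n I]`, not the optimal one. The
subtracted term is half the slope `n⁻⁶ / 2` in `δ` that `(1 - e^{-δ}) n⁻⁴ / 2` is guaranteed on
`0 ≤ δ ≤ log n²`; the halving turns the linear bound into an exponential one. -/
noncomputable def logMeanRate (n : ℕ) : ℝ := 1 - ((n : ℝ)⁻¹) ^ 6 / 4

theorem logMeanRate_pos {n : ℕ} (hn : 1 ≤ n) : 0 < logMeanRate n := by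
  have h : ((n : ℝ)⁻¹) ^ 6 ≤ 1 :=
    pow_le_one₀ (by positivity) (inv_le_one_of_one_le₀ (by exact_mod_cast hn))
  rw [logMeanRate]
  linarith

theorem logMeanRate_lt_one {n : ℕ} (hn : 1 ≤ n) : logMeanRate n < 1 := by
  have hn0 : (0 : ℝ) < n := by exact_mod_cast hn
  have h : 0 < ((n : ℝ)⁻¹) ^ 6 := by positivity
  rw [logMeanRate]
  linarith

theorem exp_mul_le_one_add_of_le_log {n : ℕ} (hn : 1 ≤ n) {δ : ℝ} (hδ : 0 ≤ δ)
    (hδn : δ ≤ Real.log ((n : ℝ) ^ 2)) :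
    Real.exp ((1 - logMeanRate n) * δ) ≤ 1 + (1 - Real.exp (-δ)) * ((n : ℝ)⁻¹ ^ 4 / 2) := by
  have hn1 : (1 : ℝ) ≤ n := by exact_mod_cast hn
  have hn0 : (0 : ℝ) < n := one_pos.trans_le hn1
  have hi0 : 0 < (n : ℝ)⁻¹ := inv_pos.2 hn0
  have hi1 : (n : ℝ)⁻¹ ≤ 1 := inv_le_one_of_one_le₀ hn1
  have hexp : (n : ℝ)⁻¹ ^ 2 ≤ Real.exp (-δ) := by
    rw [Real.exp_neg, inv_pow]
    exact inv_anti₀ (Real.exp_pos _) ((Real.le_log_iff_exp_le (by positivity)).1 hδn)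
  -- `1 - exp (-δ) ≥ δ exp (-δ)`
  have hlow : δ * (n : ℝ)⁻¹ ^ 2 ≤ 1 - Real.exp (-δ) := by
    have h1 : (δ + 1) * Real.exp (-δ) ≤ 1 := by
      have := mul_le_mul_of_nonneg_right (Real.add_one_le_exp δ) (Real.exp_pos (-δ)).le
      rwa [← Real.exp_add, add_neg_cancel, Real.exp_zero] at this
    have h2 := mul_le_mul_of_nonneg_left hexp hδ
    linarith
  set y := (1 - logMeanRate n) * δ with hy
  have hy' : y = (n : ℝ)⁻¹ ^ 6 / 4 * δ := by rw [hy, logMeanRate]; ring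
  have hy0 : 0 ≤ y := by rw [hy']; positivity
  have hy1 : y ≤ 1 := by
    have h1 : δ ≤ (n : ℝ) ^ 2 := hδn.trans ((Real.log_le_sub_one_of_pos (by positivity)).trans
      (by linarith))
    have h2 : (n : ℝ)⁻¹ ^ 2 * δ ≤ 1 := by
      rw [inv_pow, inv_mul_le_iff₀ (by positivity)]
      linarith
    have h3 : (n : ℝ)⁻¹ ^ 4 ≤ 1 := pow_le_one₀ hi0.le hi1
    have h4 : (n : ℝ)⁻¹ ^ 4 * ((n : ℝ)⁻¹ ^ 2 * δ) ≤ 1 := mul_le_one₀ h3 (by positivity) h2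
    have h5 : y = (n : ℝ)⁻¹ ^ 4 * ((n : ℝ)⁻¹ ^ 2 * δ) / 4 := by rw [hy']; ring
    linarith
  have h1 : Real.exp y ≤ 1 + 2 * y := by
    have h := (abs_le.1 (Real.abs_exp_sub_one_sub_id_le (by rwa [abs_of_nonneg hy0]))).2
    nlinarith
  have h2 : 2 * y = δ * (n : ℝ)⁻¹ ^ 2 * ((n : ℝ)⁻¹ ^ 4 / 2) := by rw [hy']; ring
  have h3 := mul_le_mul_of_nonneg_right hlow (show 0 ≤ (n : ℝ)⁻¹ ^ 4 / 2 by positivity)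
  linarith

/-- With `δ = d(B, C)`, monotonicity and homogeneity bound `L(A, B)` by `e^δ L(e^{-δ} A, C)`, and the
shrunken first argument gives back a fixed fraction of the exponent `δ`. -/
theorem opLogMean_le_exp_smul {n : ℕ} (hn : 1 ≤ n) {A B C : PosOp E} (hA : A ∈ orderInterval E n)
    (hB : B ∈ orderInterval E n) (hC : C ∈ orderInterval E n) :
    (opLogMean A B).op ≤ Real.exp (logMeanRate n * dist B C) • (opLogMean A C).op := by
  have hn1 : (1 : ℝ) ≤ n := by exact_mod_cast hn
  set δ := dist B C with hδ
  have hδ0 : 0 ≤ δ := dist_nonneg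
  refine opLogMean_le_smul (Real.exp_pos _) ?_
  have hest := one_add_smul_invLogMean_le hn1 (Real.exp_pos (-δ))
    (Real.exp_le_one_iff.2 (neg_nonpos.2 hδ0)) (by simpa only [one_div] using hA.1) hA.2
    (by simpa only [one_div] using hC.1) hC.2
  have hJ := (isStrictlyPositive_invLogMean A C).nonneg
  calc (Real.exp (logMeanRate n * δ))⁻¹ • invLogMean A.op C.op
      = Real.exp (-δ) • (Real.exp ((1 - logMeanRate n) * δ) • invLogMean A.op C.op) := by
        rw [smul_smul, ← Real.exp_add, ← Real.exp_neg]
        congr 2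
        ring
    _ ≤ Real.exp (-δ) • invLogMean (Real.exp (-δ) • A.op) C.op :=
        smul_le_smul_of_nonneg_left ((smul_le_smul_of_nonneg_right
          (exp_mul_le_one_add_of_le_log hn hδ0 (dist_le_of_mem_orderInterval hn hB hC)) hJ).trans
          hest) (Real.exp_pos _).le
    _ = invLogMean A.op (Real.exp δ • C.op) := by
        have h := invLogMean_smul (Real.exp_pos δ).ne' (Real.exp (-δ) • A.op) C.op
        rw [smul_smul, ← Real.exp_add, add_neg_cancel, Real.exp_zero, one_smul,
          ← Real.exp_neg] at h
        exact h.symm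
    _ ≤ invLogMean A.op B.op :=
        invLogMean_anti A.isStrictlyPositive B.isStrictlyPositive le_rfl (B.op_le_exp_dist_smul C)

theorem dist_opLogMean_right_le {n : ℕ} (hn : 1 ≤ n) {A B C : PosOp E}
    (hA : A ∈ orderInterval E n) (hB : B ∈ orderInterval E n) (hC : C ∈ orderInterval E n) :
    dist (opLogMean A B) (opLogMean A C) ≤ logMeanRate n * dist B C := by
  refine (PosOp.dist_le_iff (mul_nonneg (logMeanRate_pos hn).le dist_nonneg)).2
    ⟨opLogMean_le_exp_smul hn hA hB hC, ?_⟩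
  rw [dist_comm B C]
  exact opLogMean_le_exp_smul hn hA hC hB

theorem isLocallyContractiveMean_logMean : IsLocallyContractiveMean
    (fun n : ℕ => orderInterval E (n + 1)) (fun n => logMeanRate (n + 1)) (logMean E) where
  isMean A := opLogMean_self A
  nonexpansive x y := (dist_opLogMean_le _ _ _ _).trans
    (max_le (dist_le_pi_dist x y 0) (dist_le_pi_dist x y 1))
  symm σ x := by
    have h : σ 0 ≠ σ 1 := fun h => absurd (σ.injective h) (by decide)
    have h2 : (σ 0 = 0 ∧ σ 1 = 1) ∨ (σ 0 = 1 ∧ σ 1 = 0) := by omega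
    simp only [logMean, Function.comp_apply]
    rcases h2 with ⟨h0, h1⟩ | ⟨h0, h1⟩
    · rw [h0, h1]
    · rw [h0, h1, opLogMean_comm]
  convex n _ hx := opLogMean_mem_orderInterval n.succ_pos (hx 0) (hx 1)
  contractive n x y j hx hy hxy := by
    have hj : j = 0 ∨ j = 1 := by omega
    simp only [logMean]
    rcases hj with rfl | rfl
    · rw [hxy 1 (by decide), opLogMean_comm, opLogMean_comm (y 0)]
      exact dist_opLogMean_right_le n.succ_pos (hy 1) (hx 0) (hy 0)
    · rw [hxy 0 (by decide)]
      exact dist_opLogMean_right_le n.succ_pos (hy 0) (hx 1) (hy 1)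

end Contraction

end OperatorMeans

theorem mainTheorem1 (E : Type*) [NormedAddCommGroup E] [InnerProductSpace ℂ E]
    [CompleteSpace E] :
    (∀ n : ℕ, 1 ≤ n →
      ∃ h : OperatorMeans.IsConvexFor (OperatorMeans.logMean E) (OperatorMeans.orderInterval E n),
        OperatorMeans.IsMean (OperatorMeans.restrictMean (OperatorMeans.logMean E) _ h) ∧
        OperatorMeans.Nonexpansive (OperatorMeans.restrictMean (OperatorMeans.logMean E) _ h) ∧
        ∃ ρ : ℝ, 0 < ρ ∧ ρ < 1 ∧
          OperatorMeans.CoordinatewiseContractive ρ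
            (OperatorMeans.restrictMean (OperatorMeans.logMean E) _ h)) ∧
    OperatorMeans.InductivelyBetaExtends (OperatorMeans.logMean E) := by
  have hL := OperatorMeans.isLocallyContractiveMean_logMean (E := E)
  refine ⟨fun n hn => ?_, ?_⟩
  · obtain ⟨m, rfl⟩ : ∃ m, n = m + 1 := ⟨n - 1, by omega⟩
    refine ⟨hL.convex m, fun A => Subtype.ext (hL.isMean _), fun x y => ?_,
      OperatorMeans.logMeanRate (m + 1), OperatorMeans.logMeanRate_pos hn,
      OperatorMeans.logMeanRate_lt_one hn, fun x y j hxy => ?_⟩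
    · exact hL.nonexpansive (fun i => (x i : OperatorMeans.PosOp E)) (fun i => y i)
    · exact hL.contractive m (fun i => x i) (fun i => y i) j (fun i => (x i).2) (fun i => (y i).2)
        fun i hi => congrArg Subtype.val (hxy i hi)
  · have : Nonempty (OperatorMeans.PosOp E) := ⟨⟨1, isStrictlyPositive_one⟩⟩
    exact hL.inductivelyBetaExtends
      (fun n => OperatorMeans.isComplete_orderInterval n.succ_pos)
      (fun n => (OperatorMeans.logMeanRate_pos n.succ_pos).le)
      (fun n => OperatorMeans.logMeanRate_lt_one n.succ_pos)
      (fun _ x => OperatorMeans.exists_forall_mem_orderInterval x)
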